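/- For a finite set $X$ of points in Euclidean space $\mathbb{R}^n$, let $\mathcal{R}$ be the Rips complex of $X$ at scale $1$: the abstract simplicial complex with vertex set $X$ whose simplices are the nonempty subsets of $X$ of diameter at most $1$. Let $p\colon|\mathcal{R}|\to\mathbb{R}^n$ be the canonical projection from its geometric realization, which fixes the points of $X$ and is affine on each simplex, and let the shadow be its image $\mathcal{S}=p(|\mathcal{R}|)$ with the subspace topology. A continuous map is called $k$-connected if, for all base points, it induces isomorphisms on the homotopy groups $\pi_i$ for all $0\le i\le k$ (a bijection of path components for $i=0$). **Proposition.** There is a set of six distinct points in $\mathbb{R}^4$ such that $\mathcal{R}$ is isomorphic, as a simplicial complex, to the boundary complex of an octahedron (its simplices are the nonempty sets of vertices of the octahedron that contain no two antipodal vertices), hence $|\mathcal{R}|$ is simply connected, while $\mathcal{S}$ is path-connected with $\pi_1(\mathcal{S},y)\cong\mathbb{Z}$ for every base point $y\in\mathcal{S}$. In particular, $p\colon|\mathcal{R}|\to\mathcal{S}$ is not $1$-connected. -/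

import Mathlib

open Topology

namespace RipsShadow

/-! ### The Rips complex at scale `1` -/

/-- The (Vietoris-)Rips complex at scale `1` of a family of points `p v`, `v : V`, in a metric
space: a nonempty finite set of indices is a simplex iff its points have diameter at most `1`. -/
def ripsComplex {V E : Type*} [PseudoMetricSpace E] (p : V → E) : AbstractSimplicialComplex V where
  faces := {s | s.Nonempty ∧ Metric.diam (p '' (s : Set V)) ≤ 1}
  isRelLowerSet_faces := by
    rintro s ⟨hs, hd⟩
    refine ⟨hs, fun t hts ht => ⟨ht, le_trans (Metric.diam_mono ?_ ?_) hd⟩⟩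
    · exact Set.image_mono (by exact_mod_cast hts)
    · exact (s.finite_toSet.image p).isBounded
  singleton_mem := fun v => by simp

/-- Two abstract simplicial complexes are isomorphic if some bijection between their vertex sets
preserves and reflects simplices. -/
def Isomorphic {V W : Type*} (K : AbstractSimplicialComplex V) (L : AbstractSimplicialComplex W) :
    Prop :=
  ∃ e : V ≃ W, ∀ s : Finset V, s ∈ K.faces ↔ s.map e.toEmbedding ∈ L.faces

/-- The boundary complex of the octahedron with vertices `±e₀, ±e₁, ±e₂`. The pair `(i, b)` stands
for the vertex `e_i` or `-e_i`, according to `b`. The simplices are the nonempty vertex sets that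
contain no pair of antipodal vertices: 6 vertices, 12 edges and 8 triangles. -/
def octahedron : AbstractSimplicialComplex (Fin 3 × Bool) where
  faces := {s | s.Nonempty ∧ ∀ i : Fin 3, ¬ ((i, true) ∈ s ∧ (i, false) ∈ s)}
  isRelLowerSet_faces := by
    rintro s ⟨hs, hd⟩
    exact ⟨hs, fun t hts ht => ⟨ht, fun i hi => hd i ⟨hts hi.1, hts hi.2⟩⟩⟩
  singleton_mem := fun v => by
    refine ⟨Finset.singleton_nonempty v, fun i hi => ?_⟩
    have h1 := Finset.mem_singleton.1 hi.1
    have h2 := Finset.mem_singleton.1 hi.2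
    have h3 : (i, true) = (i, false) := h1.trans h2.symm
    simp at h3

/-! ### Geometric realization, projection and shadow -/

/-- The geometric realization of an abstract simplicial complex on a finite vertex set `V`: the
points of the standard simplex in `ℝ^V` (barycentric coordinates) whose support lies in a simplex.
It carries the subspace topology of `ℝ^V`. -/
def realization {V : Type*} [Fintype V] (K : AbstractSimplicialComplex V) : Set (V → ℝ) :=
  {w | w ∈ stdSimplex ℝ V ∧ ∃ s ∈ K.faces, ∀ v, w v ≠ 0 → v ∈ s}

/-- The map from the realization to `E` that is affine on each simplex and sends the vertex `v`
to `p v`. -/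
def projFun {V E : Type*} [Fintype V] [AddCommGroup E] [Module ℝ E]
    (K : AbstractSimplicialComplex V) (p : V → E) (w : realization K) : E :=
  ∑ v, w.1 v • p v

/-- The shadow: the image of the projection, with the subspace topology of `E`. -/
def shadow {V E : Type*} [Fintype V] [AddCommGroup E] [Module ℝ E]
    (K : AbstractSimplicialComplex V) (p : V → E) : Set E :=
  Set.range (projFun K p)

/-- The canonical projection of the realization onto the shadow, as a continuous map. -/
def proj {V E : Type*} [Fintype V] [NormedAddCommGroup E] [NormedSpace ℝ E]
    (K : AbstractSimplicialComplex V) (p : V → E) : C(realization K, shadow K p) where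
  toFun w := ⟨projFun K p w, Set.mem_range_self w⟩
  continuous_toFun := by
    refine Continuous.subtype_mk ?_ _
    exact continuous_finsetSum _ fun v _ =>
      ((continuous_apply v).comp continuous_subtype_val).smul continuous_const

/-! ### Connectivity of a map -/

/-- The map induced by a continuous map on the sets of path components. -/
def zerothMap {X Y : Type*} [TopologicalSpace X] [TopologicalSpace Y] (f : C(X, Y)) :
    ZerothHomotopy X → ZerothHomotopy Y :=
  Quotient.map f fun _ _ h => h.map f.continuous

/-- The map `π_n(X, x) → π_n(Y, f x)` induced by a continuous map, by composition. -/
def homotopyGroupMap {X Y : Type*} [TopologicalSpace X] [TopologicalSpace Y] (n : ℕ)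
    (f : C(X, Y)) (x : X) : HomotopyGroup.Pi n X x → HomotopyGroup.Pi n Y (f x) :=
  Quotient.map (fun g => (⟨f.comp g.1, fun y hy => congrArg f (g.2 y hy)⟩ : GenLoop (Fin n) Y (f x)))
    fun _ _ h => h.map fun H => H.compContinuousMap f

/-- A continuous map is `k`-connected if it induces a bijection on path components and
isomorphisms on `π_i` for `1 ≤ i ≤ k` at every base point. (For `i ≥ 1` the induced map is a group
homomorphism, so it is an isomorphism iff it is bijective.) -/
def IsKConnectedMap {X Y : Type*} [TopologicalSpace X] [TopologicalSpace Y] (k : ℕ)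
    (f : C(X, Y)) : Prop :=
  Function.Bijective (zerothMap f) ∧
    ∀ i : ℕ, 1 ≤ i → i ≤ k → ∀ x : X, Function.Bijective (homotopyGroupMap i f x)

end RipsShadow

/-! The boundary of an octahedron is a sphere, so the realization is simply connected. The six
points affinely span `ℝ⁴`, hence their affine dependences form a line, here spanned by `(1, 1, 1,
-1, -1, -1)`. Two points of the realization with the same projection have barycentric coordinates
that differ by a multiple of this vector. Since antipodal vertices never both carry weight, the only
distinct such points are the barycenters of the opposite triangles `012` and `345`
(`projFun_eq_iff`). The shadow is therefore a sphere with two points glued.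

The universal cover of such a space is an infinite chain of spheres, each touching the next, with
`ℤ` acting by translation. It is realized as a surface of revolution, `sphereChain`, and is simply
connected by a van Kampen type argument (`simplyConnectedSpace_of_chain`). Its quotient by `ℤ` then
has fundamental group `ℤ` (`nonempty_fundamentalGroup_mulEquiv_int_of_gluing`). One sphere is a
retract of the chain, which also gives the simple connectedness of the realization through
`ripsHomeomorph`. Finally, a trivial group cannot surject onto `ℤ`, so the projection is not
`1`-connected. -/

/-! ### Criteria for simple connectedness. -/

open unitInterval in
/-- If classes of paths `e x` from a base point are compatible with every path that stays in one
member of an open cover, then the space is simply connected. -/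
theorem simplyConnectedSpace_of_openCover {X ι : Type*} [TopologicalSpace X] {W : ι → Set X}
    (hW : ∀ i, IsOpen (W i)) (hcov : ∀ x, ∃ i, x ∈ W i) {x₀ : X}
    (e : ∀ x, Path.Homotopic.Quotient x₀ x)
    (he : ∀ i, ∀ {x y : X} (γ : Path x y), (∀ s, γ s ∈ W i) → (e x).trans (.mk γ) = e y) :
    SimplyConnectedSpace X := by
  -- Compatibility extends to every path by cutting it into finitely many pieces, each inside one
  -- member of the cover. Two paths `p`, `q` from `x` to `y` then agree after composition with `e
  -- x`, which can be cancelled.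
  have key : ∀ {x y : X} (γ : Path x y), (e x).trans (.mk γ) = e y := by
    intro x y γ
    obtain ⟨t, t0, tmono, ⟨N, hN⟩, ht⟩ := exists_monotone_Icc_subset_open_cover_unitInterval
      (c := fun i => γ ⁻¹' W i) (fun i => (hW i).preimage γ.continuous)
      (fun s _ => Set.mem_iUnion.2 (hcov (γ s)))
    have step : ∀ n, (e (γ 0)).trans (.mk (γ.subpath 0 (t n))) = e (γ (t n)) := by
      intro n
      induction n with
      | zero => rw [t0, Path.subpath_self]; simp
      | succ n ih =>
        obtain ⟨i, hi⟩ := ht n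
        have h1 : Path.Homotopic.Quotient.mk (γ.subpath 0 (t (n + 1))) =
            (Path.Homotopic.Quotient.mk (γ.subpath 0 (t n))).trans
              (.mk (γ.subpath (t n) (t (n + 1)))) := by
          rw [← Path.Homotopic.Quotient.mk_trans]
          exact (Path.Homotopic.Quotient.eq.2
            ⟨Path.Homotopy.subpathTransSubpath γ 0 (t n) (t (n + 1))⟩).symm
        rw [h1, ← Path.Homotopic.Quotient.trans_assoc, ih]
        refine he i _ fun s => ?_
        have hs : γ.subpath (t n) (t (n + 1)) s ∈ Set.range (γ.subpath (t n) (t (n + 1))) :=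
          ⟨s, rfl⟩
        rw [Path.range_subpath_of_le _ _ _ (tmono n.le_succ)] at hs
        obtain ⟨u, hu, hus⟩ := hs
        rw [← hus]
        exact hi hu
    have h := step N
    rw [hN N le_rfl, Path.subpath_zero_one] at h
    -- The endpoints `γ 0`, `γ 1` equal `x`, `y` only propositionally; destructuring the path makes
    -- them the endpoints by definition.
    obtain ⟨c, c0, c1⟩ := γ
    subst c0 c1
    exact h
  rw [simply_connected_iff_paths_homotopic']
  refine ⟨⟨⟨x₀⟩, fun x y => ?_⟩, fun {x y} p q => ?_⟩
  · have hj : ∀ z, Joined x₀ z := fun z => ⟨(e z).out⟩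
    exact (hj x).symm.trans (hj y)
  · rw [← Path.Homotopic.Quotient.eq]
    have h : (e x).trans (.mk p) = (e x).trans (.mk q) := (key p).trans (key q).symm
    have h2 := congrArg (fun z => (e x).symm.trans z) h
    simpa [← Path.Homotopic.Quotient.trans_assoc] using h2

/-- Two paths that stay in a simply connected subset are homotopic. -/
theorem IsSimplyConnected.mk_eq_mk {X : Type*} [TopologicalSpace X] {s : Set X}
    (hs : IsSimplyConnected s) {x y : X} (γ γ' : Path x y) (h : ∀ t, γ t ∈ s)
    (h' : ∀ t, γ' t ∈ s) :
    Path.Homotopic.Quotient.mk γ = Path.Homotopic.Quotient.mk γ' := by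
  have := hs.simplyConnectedSpace
  have hx : x ∈ s := by simpa using h 0
  have hy : y ∈ s := by simpa using h 1
  let δ : Path (⟨x, hx⟩ : s) ⟨y, hy⟩ :=
    { toFun := fun t => ⟨γ t, h t⟩, source' := by simp, target' := by simp }
  let δ' : Path (⟨x, hx⟩ : s) ⟨y, hy⟩ :=
    { toFun := fun t => ⟨γ' t, h' t⟩, source' := by simp, target' := by simp }
  exact Path.Homotopic.Quotient.eq.2
    ((SimplyConnectedSpace.paths_homotopic δ δ').map ⟨Subtype.val, continuous_subtype_val⟩)

/-- A space over the real line with a section is simply connected if its parts over the intervals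
`(n - 1, n + 1)` are simply connected and its parts over `(n, n + 1)` are path-connected. -/
theorem simplyConnectedSpace_of_chain {X : Type*} [TopologicalSpace X] {t : X → ℝ}
    (ht : Continuous t) {σ : ℝ → X} (hσ : Continuous σ) (htσ : ∀ s, t (σ s) = s)
    (hsc : ∀ n : ℤ, IsSimplyConnected {x | |t x - n| < 1})
    (hpc : ∀ n : ℤ, IsPathConnected {x | (n : ℝ) < t x ∧ t x < n + 1}) :
    SimplyConnectedSpace X := by
  have hC : ∀ (n : ℤ) (x y : X), |t x - n| < 1 → |t y - n| < 1 →
      ∃ γ : Path x y, ∀ s, |t (γ s) - n| < 1 := fun n x y hx hy => by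
    obtain ⟨γ, hγ⟩ := (hsc n).isPathConnected.joinedIn x hx y hy
    exact ⟨γ, hγ⟩
  have hσn : ∀ n : ℤ, |t (σ n) - n| < 1 := fun n => by simp [htσ]
  let S : ∀ a b : ℝ, Path (σ a) (σ b) := fun a b => (Path.segment a b).map hσ
  have hS : ∀ a b c : ℝ, (Path.Homotopic.Quotient.mk (S a b)).trans (.mk (S b c)) =
      .mk (S a c) := fun a b c => by
    rw [← Path.Homotopic.Quotient.mk_trans, Path.Homotopic.Quotient.eq]
    have := (SimplyConnectedSpace.paths_homotopic
      ((Path.segment a b).trans (Path.segment b c)) (Path.segment a c)).map ⟨σ, hσ⟩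
    rwa [Path.map_trans] at this
  have htS : ∀ a b s, t (S a b s) = (1 - s) * a + s * b := fun a b s => by
    simp only [S, Path.map_coe, Function.comp_apply, htσ, Path.segment_apply,
      AffineMap.lineMap_apply, vsub_eq_sub, smul_eq_mul, vadd_eq_add]
    ring
  have hfl : ∀ x, |t x - ⌊t x⌋| < 1 := fun x => by
    rw [abs_of_nonneg (by linarith [Int.floor_le (t x)])]
    linarith [Int.lt_floor_add_one (t x)]
  -- On the overlap of two consecutive slabs both choices give the same class: each is compared,
  -- inside its own slab, with a path that follows the section to height `n + 1 / 2` and then stays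
  -- in the overlap.
  have hswitch : ∀ (n : ℤ) {x : X} (γ : Path (σ n) x) (γ' : Path (σ (n + 1 : ℤ)) x),
      (∀ s, |t (γ s) - n| < 1) → (∀ s, |t (γ' s) - (n + 1 : ℤ)| < 1) →
      (Path.Homotopic.Quotient.mk (S 0 n)).trans (.mk γ) =
        (Path.Homotopic.Quotient.mk (S 0 (n + 1 : ℤ))).trans (.mk γ') := by
    intro n x γ γ' hγ hγ'
    have hx := hγ 1
    have hx' := hγ' 1
    rw [Path.target, abs_lt] at hx hx'
    push_cast at hx'
    obtain ⟨δ, hδ⟩ := (hpc n).joinedIn (σ (n + 1 / 2)) (by simp [htσ]; norm_num) x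
      ⟨by linarith, by linarith⟩
    simp only [Set.mem_ofPred_eq] at hδ
    have h1 : Path.Homotopic.Quotient.mk γ =
        (Path.Homotopic.Quotient.mk (S n (n + 1 / 2))).trans (.mk δ) := by
      refine (hsc n).mk_eq_mk γ ((S n (n + 1 / 2)).trans δ) hγ fun s => ?_
      have : (S n (n + 1 / 2)).trans δ s ∈ Set.range ((S n (n + 1 / 2)).trans δ) := ⟨s, rfl⟩
      rw [Path.trans_range] at this
      rcases this with ⟨u, hu⟩ | ⟨u, hu⟩ <;> rw [← hu, Set.mem_ofPred_eq, abs_lt]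
      · rw [htS]; constructor <;> linarith [u.2.1, u.2.2]
      · constructor <;> linarith [hδ u]
    have h2 : Path.Homotopic.Quotient.mk γ' =
        (Path.Homotopic.Quotient.mk (S (n + 1 : ℤ) (n + 1 / 2))).trans (.mk δ) := by
      refine (hsc (n + 1)).mk_eq_mk γ' ((S (n + 1 : ℤ) (n + 1 / 2)).trans δ) hγ' fun s => ?_
      have : (S (n + 1 : ℤ) (n + 1 / 2)).trans δ s ∈
        Set.range ((S (n + 1 : ℤ) (n + 1 / 2)).trans δ) := ⟨s, rfl⟩
      rw [Path.trans_range] at this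
      rcases this with ⟨u, hu⟩ | ⟨u, hu⟩ <;> rw [← hu, Set.mem_ofPred_eq, abs_lt] <;> push_cast
      · rw [htS]; push_cast; constructor <;> linarith [u.2.1, u.2.2]
      · constructor <;> linarith [hδ u]
    rw [h1, h2, ← Path.Homotopic.Quotient.trans_assoc, ← Path.Homotopic.Quotient.trans_assoc,
      hS, hS]
  -- The chosen class follows the section to height `⌊t x⌋`, then goes to `x` inside the slab around
  -- that integer. By `hkey` any other slab containing `x` would do as well.
  let e : ∀ x, Path.Homotopic.Quotient (σ 0) x := fun x =>
    (Path.Homotopic.Quotient.mk (S 0 ⌊t x⌋)).trans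
      (.mk (hC ⌊t x⌋ (σ ⌊t x⌋) x (hσn _) (hfl x)).choose)
  have hC' : ∀ x s, |t ((hC ⌊t x⌋ (σ ⌊t x⌋) x (hσn _) (hfl x)).choose s) - ⌊t x⌋| < 1 :=
    fun x => (hC ⌊t x⌋ (σ ⌊t x⌋) x (hσn _) (hfl x)).choose_spec
  have hkey : ∀ (n : ℤ) {x : X} (γ : Path (σ n) x), (∀ s, |t (γ s) - n| < 1) →
      (Path.Homotopic.Quotient.mk (S 0 n)).trans (.mk γ) = e x := by
    intro n x γ hγ
    have hx := hγ 1
    rw [Path.target, abs_lt] at hx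
    have hn : n = ⌊t x⌋ ∨ n = ⌊t x⌋ + 1 := by
      have h1 : n < ⌊t x⌋ + 2 := by
        have := Int.lt_floor_add_one (t x)
        exact_mod_cast (by linarith : (n : ℝ) < ⌊t x⌋ + 2)
      have h2 : ⌊t x⌋ < n + 1 := by
        have := Int.floor_le (t x)
        exact_mod_cast (by linarith : (⌊t x⌋ : ℝ) < n + 1)
      omega
    rcases hn with rfl | rfl
    · exact congrArg _ ((hsc _).mk_eq_mk _ _ hγ (hC' x))
    · exact (hswitch _ _ _ (hC' x) hγ).symm
  refine simplyConnectedSpace_of_openCover (W := fun n : ℤ => {x | |t x - n| < 1})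
    (fun n => isOpen_lt (by fun_prop) continuous_const) (fun x => ⟨⌊t x⌋, hfl x⟩) e ?_
  intro n x y γ hγ
  have hx : |t x - n| < 1 := by simpa using hγ 0
  obtain ⟨δ, hδ⟩ := hC n (σ n) x (hσn n) hx
  rw [← hkey n δ hδ, Path.Homotopic.Quotient.trans_assoc, ← Path.Homotopic.Quotient.mk_trans]
  refine hkey n _ fun s => ?_
  have : δ.trans γ s ∈ Set.range (δ.trans γ) := ⟨s, rfl⟩
  rw [Path.trans_range] at this
  rcases this with ⟨u, hu⟩ | ⟨u, hu⟩ <;> rw [← hu]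
  exacts [hδ u, hγ u]

/-- A retract of a simply connected space is simply connected. -/
theorem SimplyConnectedSpace.of_retract {X A : Type*} [TopologicalSpace X] [TopologicalSpace A]
    [SimplyConnectedSpace X] (i : C(A, X)) (r : C(X, A)) (h : ∀ a, r (i a) = a) :
    SimplyConnectedSpace A := by
  have hs : Function.Surjective r := fun a => ⟨i a, h a⟩
  rw [simply_connected_iff_paths_homotopic']
  refine ⟨hs.pathConnectedSpace r.continuous, fun {x y} p q => ?_⟩
  obtain ⟨H⟩ := (SimplyConnectedSpace.paths_homotopic (p.map i.continuous)
    (q.map i.continuous)).map r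
  have hc : ∀ p : Path x y, ((p.map i.continuous).map r.continuous).cast (h x).symm (h y).symm
      = p := fun p => by ext s; simp [h]
  exact ⟨(H.pathCast (h x).symm (h y).symm).cast (hc p) (hc q)⟩

/-! ### The chain of spheres and its simple connectedness. -/

/-- A chain of spheres along the real line: the surface of revolution with profile
`|sin (π t)|`. Consecutive spheres touch at the points `(n, 0)`. -/
def sphereChain : Set (ℝ × ℂ) := {q | ‖q.2‖ = |Real.sin (Real.pi * q.1)|}

/-- The sphere of the chain between `0` and `1`. -/
def chainLink : Set (ℝ × ℂ) := {q | q ∈ sphereChain ∧ 0 ≤ q.1 ∧ q.1 ≤ 1}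

theorem abs_sin_pi_mul_add_int (t : ℝ) (n : ℤ) :
    |Real.sin (Real.pi * (t + n))| = |Real.sin (Real.pi * t)| := by
  rw [show Real.pi * (t + n) = Real.pi * t + n * Real.pi by ring, Real.sin_add_int_mul_pi, abs_mul,
    abs_zpow, abs_neg, abs_one, one_zpow, one_mul]

theorem abs_sin_pi_mul_sub_int (t : ℝ) (n : ℤ) :
    |Real.sin (Real.pi * (t - n))| = |Real.sin (Real.pi * t)| := by
  simpa using (abs_sin_pi_mul_add_int (t - n) n).symm

theorem mul_sinc_eq_sin (x : ℝ) : x * Real.sinc x = Real.sin x := by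
  rcases eq_or_ne x 0 with rfl | hx
  · simp
  · rw [Real.sinc_of_ne_zero hx, mul_div_cancel₀ _ hx]

theorem sinc_pi_mul_ne_zero {s : ℝ} (hs : |s| < 1) : Real.sinc (Real.pi * s) ≠ 0 := by
  rcases eq_or_ne s 0 with rfl | h0
  · simp
  · intro h
    have hz : Real.sin (Real.pi * s) = 0 := by rw [← mul_sinc_eq_sin, h, mul_zero]
    rw [abs_lt] at hs
    have hpi := Real.pi_pos
    rw [Real.sin_eq_zero_iff_of_lt_of_lt (by nlinarith) (by nlinarith)] at hz
    rcases mul_eq_zero.1 hz with h | h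
    exacts [hpi.ne' h, h0 h]

/-- The slab consists of two open discs joined at the point `(n, 0)`, and it contracts to that
point. -/
theorem isSimplyConnected_sphereChain_slab (n : ℤ) :
    IsSimplyConnected {x : sphereChain | |x.1.1 - n| < 1} := by
  set W := {x : sphereChain | |x.1.1 - n| < 1} with hW
  have hne : ∀ x : W, Real.sinc (Real.pi * (x.1.1.1 - n)) ≠ 0 := fun x => sinc_pi_mul_ne_zero x.2
  -- With `s` the height above `n`, the contraction replaces `s` by `l * s`, and the radius must
  -- change by the factor `sin (π l s) / sin (π s)`. Writing it with `sinc` keeps it continuous at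
  -- `s = 0`, where the quotient of sines is undefined.
  have hmem : ∀ (l : unitInterval) (x : W), ((n + l * (x.1.1.1 - n),
      ((l * Real.sinc (Real.pi * (l * (x.1.1.1 - n))) / Real.sinc (Real.pi * (x.1.1.1 - n)) : ℝ) : ℂ)
        * x.1.1.2) : ℝ × ℂ) ∈ sphereChain := by
    intro l x
    have hx : ‖x.1.1.2‖ = |Real.sin (Real.pi * x.1.1.1)| := x.1.2
    have h1 := abs_sin_pi_mul_sub_int (n + l * (x.1.1.1 - n)) n
    have h2 := abs_sin_pi_mul_sub_int x.1.1.1 n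
    have hne := hne x
    simp only [sphereChain, Set.mem_ofPred_eq, norm_mul, Complex.norm_real, Real.norm_eq_abs, hx]
    rw [← h1, ← h2, add_sub_cancel_left, ← mul_sinc_eq_sin, ← mul_sinc_eq_sin (_ * (l * _)),
      abs_div, abs_mul, abs_mul, abs_mul, abs_mul, abs_mul, abs_mul]
    field_simp
  have hslab : ∀ (l : unitInterval) (x : W), |(n + l * (x.1.1.1 - n) : ℝ) - n| < 1 := by
    intro l x
    have hx : |x.1.1.1 - n| < 1 := x.2
    rw [add_sub_cancel_left, abs_mul, abs_of_nonneg l.2.1]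
    nlinarith [l.2.1, l.2.2, abs_nonneg (x.1.1.1 - n)]
  have h0 : ((n, 0) : ℝ × ℂ) ∈ sphereChain := by
    simp [sphereChain, mul_comm Real.pi]
  have : ContractibleSpace W := by
    rw [contractible_iff_id_nullhomotopic]
    refine ⟨⟨⟨_, h0⟩, by simp [hW]⟩, ⟨ContinuousMap.Homotopy.symm
      { toFun := fun q => ⟨⟨_, hmem q.1 q.2⟩, hslab q.1 q.2⟩
        continuous_toFun := ?_
        map_zero_left := fun x => ?_
        map_one_left := fun x => ?_ }⟩⟩
    · refine Continuous.subtype_mk (Continuous.subtype_mk ?_ _) _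
      refine Continuous.prodMk (by fun_prop) (Continuous.mul ?_ (by fun_prop))
      refine Complex.continuous_ofReal.comp (Continuous.div ?_ ?_ fun q => hne q.2)
      · exact (by fun_prop : Continuous fun q : unitInterval × W => (q.1 : ℝ)).mul
          (Real.continuous_sinc.comp (by fun_prop))
      · exact Real.continuous_sinc.comp (by fun_prop)
    · ext <;> simp
    · ext <;> simp [div_self (hne x)]
  show SimplyConnectedSpace W
  infer_instance

/-- Polar coordinates present this part as a continuous image of the convex set `(n, n + 1) × ℝ`. -/
theorem isPathConnected_sphereChain_annulus (n : ℤ) :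
    IsPathConnected {x : sphereChain | (n : ℝ) < x.1.1 ∧ x.1.1 < n + 1} := by
  let f : ℝ × ℝ → sphereChain := fun q =>
    ⟨(q.1, (|Real.sin (Real.pi * q.1)| : ℝ) * Complex.exp (q.2 * Complex.I)), by
      simp [sphereChain, Complex.norm_exp_ofReal_mul_I]⟩
  have hf : Continuous f := by
    refine Continuous.subtype_mk (Continuous.prodMk (by fun_prop) (Continuous.mul ?_ (by fun_prop))) _
    exact Complex.continuous_ofReal.comp (by fun_prop)
  have hc : IsPathConnected (Set.Ioo (n : ℝ) (n + 1) ×ˢ (Set.univ : Set ℝ)) :=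
    ((convex_Ioo _ _).prod convex_univ).isPathConnected
      ⟨(n + 1 / 2, 0), ⟨by norm_num, by norm_num⟩, trivial⟩
  convert hc.image hf using 1
  ext ⟨⟨t, y⟩, hy⟩
  constructor
  · intro h
    refine ⟨(t, y.arg), ⟨h, trivial⟩, Subtype.ext (Prod.ext rfl ?_)⟩
    have hy' : ‖y‖ = |Real.sin (Real.pi * t)| := hy
    show ((|Real.sin (Real.pi * t)| : ℝ) : ℂ) * _ = y
    rw [← hy', Complex.norm_mul_exp_arg_mul_I]
  · rintro ⟨⟨s, θ⟩, ⟨hs, -⟩, h⟩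
    have : s = t := congrArg (fun z : sphereChain => z.1.1) h
    subst this
    exact hs

instance : SimplyConnectedSpace sphereChain := by
  refine simplyConnectedSpace_of_chain (t := fun x : sphereChain => x.1.1) (by fun_prop)
    (σ := fun s => ⟨(s, (|Real.sin (Real.pi * s)| : ℝ)), by simp [sphereChain]⟩) ?_ (fun s => rfl)
    isSimplyConnected_sphereChain_slab isPathConnected_sphereChain_annulus
  refine Continuous.subtype_mk (Continuous.prodMk (by fun_prop) ?_) _
  exact Complex.continuous_ofReal.comp (by fun_prop)

theorem sphereChain.eq_zero_of_int {q : ℝ × ℂ} (hq : q ∈ sphereChain) {n : ℤ} (h : q.1 = n) :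
    q.2 = 0 := by
  have hq' : ‖q.2‖ = |Real.sin (Real.pi * q.1)| := hq
  rw [h, mul_comm, Real.sin_int_mul_pi, abs_zero] at hq'
  exact norm_eq_zero.1 hq'

/-- The chain retracts onto one sphere by collapsing everything below it to the pole `(0, 0)` and
everything above it to the pole `(1, 0)`. -/
theorem simplyConnectedSpace_chainLink : SimplyConnectedSpace chainLink := by
  let g : sphereChain → ℂ := fun x => if 0 ≤ x.1.1 then (if x.1.1 ≤ 1 then x.1.2 else 0) else 0
  have hg : Continuous g := by
    refine Continuous.if_le (Continuous.if_le (by fun_prop) continuous_const (by fun_prop)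
      continuous_const fun x hx => ?_) continuous_const continuous_const (by fun_prop) fun x hx => ?_
    · exact sphereChain.eq_zero_of_int x.2 (n := 1) (by simpa using hx)
    · rw [if_pos (by linarith)]
      exact sphereChain.eq_zero_of_int x.2 (n := 0) (by simpa using hx.symm)
  have hmem : ∀ x : sphereChain, ((max 0 (min x.1.1 1), g x) : ℝ × ℂ) ∈ chainLink := by
    intro x
    refine ⟨?_, le_max_left _ _, max_le zero_le_one (min_le_right _ _)⟩
    have hx : ‖x.1.2‖ = |Real.sin (Real.pi * x.1.1)| := x.2
    simp only [sphereChain, Set.mem_ofPred_eq, g]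
    split_ifs with h0 h1
    · rw [min_eq_left h1, max_eq_right h0, hx]
    · rw [min_eq_right (not_le.1 h1).le]; simp
    · rw [max_eq_left ((min_le_left _ _).trans (not_le.1 h0).le)]; simp
  refine SimplyConnectedSpace.of_retract (X := sphereChain)
    ⟨fun x => ⟨x.1, x.2.1⟩, by fun_prop⟩
    ⟨fun x => ⟨_, hmem x⟩, Continuous.subtype_mk (by fun_prop) _⟩ fun x => ?_
  ext1
  have h0 := x.2.2.1
  have h1 := x.2.2.2
  simp [g, h0, h1]

/-! ### Integer translations and the fundamental group of the glued sphere. -/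

instance : AddAction ℤ sphereChain where
  vadd n x := ⟨(x.1.1 + n, x.1.2), x.2.trans (abs_sin_pi_mul_add_int _ _).symm⟩
  zero_vadd x := Subtype.ext (Prod.ext (by show x.1.1 + ((0 : ℤ) : ℝ) = x.1.1; simp) rfl)
  add_vadd m n x := Subtype.ext (Prod.ext
    (by show x.1.1 + ((m + n : ℤ) : ℝ) = x.1.1 + n + m; push_cast; ring) rfl)

theorem sphereChain.coe_vadd (n : ℤ) (x : sphereChain) :
    ((n +ᵥ x : sphereChain) : ℝ × ℂ) = (x.1.1 + n, x.1.2) := rfl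

/-- A quotient of the chain of spheres by the integer translations has infinite cyclic fundamental
group. -/
theorem nonempty_fundamentalGroup_mulEquiv_int {S : Type*} [TopologicalSpace S]
    {f : sphereChain → S} (hf : IsQuotientMap f)
    (hfib : ∀ x x', f x = f x' ↔ ∃ n : ℤ, n +ᵥ x' = x) (y : S) :
    Nonempty (FundamentalGroup S y ≃* Multiplicative ℤ) := by
  have hcov : IsAddQuotientCoveringMap f ℤ :=
    { __ := hf
      continuous_const_vadd := fun n => Continuous.subtype_mk
        (by fun_prop : Continuous fun x : sphereChain => (x.1.1 + n, x.1.2)) _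
      apply_eq_iff_mem_orbit := fun {x x'} => hfib x x'
      disjoint := fun x => by
        -- Heights in this neighbourhood differ by less than `1`, so only the zero translation can
        -- make it meet its translate.
        refine ⟨{x' | |x'.1.1 - x.1.1| < 1 / 2}, IsOpen.mem_nhds
          (isOpen_lt (by fun_prop) continuous_const) (by simp), fun n => ?_⟩
        rintro ⟨_, ⟨z, hz, rfl⟩, hz'⟩
        simp only [Set.mem_ofPred_eq, sphereChain.coe_vadd, abs_lt] at hz hz'
        have h1 : n < 1 := by exact_mod_cast (by linarith : (n : ℝ) < 1)
        have h2 : -1 < n := by exact_mod_cast (by linarith : (-1 : ℝ) < n)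
        omega }
  obtain ⟨x, hx⟩ := hf.surjective y
  exact ⟨(hcov.fundamentalGroupEquiv ⟨x, hx⟩).trans MulOpposite.opMulEquiv.symm⟩

theorem isCompact_chainLink : IsCompact chainLink := by
  have hcl : IsClosed chainLink := by
    have h1 : IsClosed sphereChain := isClosed_eq (f := fun q : ℝ × ℂ => ‖q.2‖)
      (g := fun q => |Real.sin (Real.pi * q.1)|) (by fun_prop) (by fun_prop)
    exact h1.inter ((isClosed_le continuous_const continuous_fst).inter
      (isClosed_le continuous_fst continuous_const))
  refine (isCompact_Icc.prod (isCompact_closedBall (0 : ℂ) 1)).of_isClosed_subset hcl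
    (s := Set.Icc (0 : ℝ) 1 ×ˢ Metric.closedBall (0 : ℂ) 1) ?_
  rintro ⟨t, y⟩ ⟨hy, h0, h1⟩
  have hy : ‖y‖ = |Real.sin (Real.pi * t)| := hy
  exact ⟨⟨h0, h1⟩, by simpa [hy] using Real.abs_sin_le_one _⟩

theorem chainLink_shift (x : sphereChain) :
    ((Int.fract x.1.1, x.1.2) : ℝ × ℂ) ∈ chainLink := by
  refine ⟨?_, Int.fract_nonneg _, (Int.fract_lt_one _).le⟩
  have hx : ‖x.1.2‖ = |Real.sin (Real.pi * x.1.1)| := x.2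
  simp only [sphereChain, Set.mem_ofPred_eq, hx, Int.fract, abs_sin_pi_mul_sub_int]

/-- The Hausdorff space obtained from the sphere `chainLink` by gluing its two poles has infinite
cyclic fundamental group. -/
theorem nonempty_fundamentalGroup_mulEquiv_int_of_gluing {S : Type*} [TopologicalSpace S]
    [T2Space S] {g : chainLink → S} (hg : Continuous g) (hsurj : Function.Surjective g)
    (hfib : ∀ x x', g x = g x' ↔ x.1.2 = x'.1.2 ∧ ∃ n : ℤ, x.1.1 = x'.1.1 + n) (y : S) :
    Nonempty (FundamentalGroup S y ≃* Multiplicative ℤ) := by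
  have : CompactSpace chainLink := isCompact_iff_compactSpace.1 isCompact_chainLink
  have : Fact ((0 : ℝ) < 1) := ⟨one_pos⟩
  -- Shifting into `chainLink` uses the fractional part, which is discontinuous. The map `c` has the
  -- same fibres and is visibly continuous, so `g` is descended to the range of `c` and then pulled
  -- back to the chain.
  let c : sphereChain → AddCircle (1 : ℝ) × ℂ := fun x => ((x.1.1 : AddCircle (1 : ℝ)), x.1.2)
  have hc : Continuous c := Continuous.prodMk
    (continuous_quotient_mk'.comp (by fun_prop : Continuous fun x : sphereChain => x.1.1))
    (by fun_prop)
  have hcfib : ∀ x x', c x = c x' ↔ x.1.2 = x'.1.2 ∧ ∃ n : ℤ, x.1.1 = x'.1.1 + n := by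
    intro x x'
    simp only [c, Prod.mk.injEq, and_comm (b := x.1.2 = x'.1.2)]
    refine and_congr_right fun _ => ?_
    rw [← sub_eq_zero, ← AddCircle.coe_sub, AddCircle.coe_eq_zero_iff]
    refine exists_congr fun n => ?_
    rw [zsmul_one, eq_sub_iff_add_eq, add_comm, eq_comm]
  let shift : sphereChain → chainLink := fun x => ⟨_, chainLink_shift x⟩
  have hshift : ∀ x : sphereChain, x.1.1 = (shift x).1.1 + (⌊x.1.1⌋ : ℤ) := fun x =>
    (Int.fract_add_floor _).symm
  let i : chainLink → sphereChain := fun x => ⟨x.1, x.2.1⟩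
  have hi : Continuous i := by fun_prop
  let c' : sphereChain → Set.range c := Set.rangeFactorization c
  have hc' : Continuous c' := hc.subtype_mk _
  have hci : ∀ x, c' (i (shift x)) = c' x := fun x =>
    Subtype.ext ((hcfib x (i (shift x))).2 ⟨rfl, ⌊x.1.1⌋, hshift x⟩).symm
  let d : C(chainLink, Set.range c) := ⟨c' ∘ i, hc'.comp hi⟩
  have hd : IsQuotientMap d := by
    refine d.continuous.isClosedMap.isQuotientMap d.continuous ?_
    rintro ⟨_, x, rfl⟩
    exact ⟨shift x, hci x⟩
  have hgq : IsQuotientMap g := hg.isClosedMap.isQuotientMap hg hsurj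
  have hdg : ∀ ⦃x x'⦄, d x = d x' → g x = g x' := fun x x' h =>
    (hfib x x').2 ((hcfib (i x) (i x')).1 (congrArg Subtype.val h))
  let φ : C(Set.range c, S) := hd.lift ⟨g, hg⟩ hdg
  have hφ : ∀ x, φ (c' (i x)) = g x := fun x =>
    congrArg (fun F : C(chainLink, S) => F x) (hd.lift_comp ⟨g, hg⟩ hdg)
  -- The restriction to the compact `chainLink` is `g`, which is already a quotient map; this passes
  -- to the map on the whole noncompact chain.
  have hfq : IsQuotientMap (φ ∘ c') := by
    refine IsQuotientMap.of_comp hi (φ.continuous.comp hc') ?_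
    convert hgq using 1
    exact funext hφ
  refine nonempty_fundamentalGroup_mulEquiv_int hfq (fun x x' => ?_) y
  simp only [Function.comp_apply]
  rw [← hci x, ← hci x', hφ, hφ, hfib]
  constructor
  · rintro ⟨hy, n, hn⟩
    refine ⟨n + ⌊x.1.1⌋ - ⌊x'.1.1⌋, Subtype.ext (Prod.ext ?_ hy.symm)⟩
    rw [sphereChain.coe_vadd]
    push_cast
    linarith [hshift x, hshift x']
  · rintro ⟨n, rfl⟩
    refine ⟨rfl, n + ⌊x'.1.1⌋ - ⌊(n +ᵥ x').1.1⌋, ?_⟩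
    have h1 := hshift (n +ᵥ x')
    have h2 := hshift x'
    have h3 : (n +ᵥ x').1.1 = x'.1.1 + n := rfl
    push_cast
    linarith

/-! ### The six points and their Rips complex. -/

namespace RipsShadow

/-- Vertices `0, 1, 2` span a triangle in the plane of the first two coordinates, and vertices
`3, 4, 5` span a triangle in a transverse plane; the two triangles meet in their barycenter `0`. -/
noncomputable def crossingTriangles : Fin 6 → EuclideanSpace ℝ (Fin 4) :=
  -- If `a₀, a₁, a₂` in `ℝ²` are the first three points, with sum zero, then vertex `i + 3` is
  -- `(-3/5 aᵢ, 4/5 aᵢ)`. This is an isometric copy of the triangle, tilted so that `aᵢ` is far from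
  -- its own copy and near the other two.
  ![!₂[0, 4 / 7, 0, 0], !₂[-1 / 2, -2 / 7, 0, 0], !₂[1 / 2, -2 / 7, 0, 0],
    !₂[0, -12 / 35, 0, 16 / 35], !₂[3 / 10, 6 / 35, -2 / 5, -8 / 35],
    !₂[-3 / 10, 6 / 35, 2 / 5, -8 / 35]]

theorem dist_crossingTriangles_le_one_iff (i j : Fin 6) :
    dist (crossingTriangles i) (crossingTriangles j) ≤ 1 ↔ i + 3 ≠ j := by
  rw [EuclideanSpace.dist_eq, Real.sqrt_le_one, Fin.sum_univ_four]
  simp only [Real.dist_eq, sq_abs]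
  fin_cases i <;> fin_cases j <;> simp [crossingTriangles] <;> norm_num

theorem crossingTriangles_injective : Function.Injective crossingTriangles := by
  intro i j h
  have h0 := congrArg (fun q : EuclideanSpace ℝ (Fin 4) => q 0) h
  have h1 := congrArg (fun q : EuclideanSpace ℝ (Fin 4) => q 1) h
  fin_cases i <;> fin_cases j <;> first
    | rfl
    | (exfalso; norm_num [crossingTriangles] at h0; done)
    | (exfalso; norm_num [crossingTriangles] at h1)

theorem mem_ripsComplex_crossingTriangles {s : Finset (Fin 6)} :
    s ∈ (ripsComplex crossingTriangles).faces ↔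
      s.Nonempty ∧ ¬ (0 ∈ s ∧ 3 ∈ s) ∧ ¬ (1 ∈ s ∧ 4 ∈ s) ∧ ¬ (2 ∈ s ∧ 5 ∈ s) := by
  have hd : Metric.diam (crossingTriangles '' (s : Set (Fin 6))) ≤ 1 ↔
      ∀ i ∈ s, ∀ j ∈ s, i + 3 ≠ j := by
    constructor
    · intro h i hi j hj
      rw [← dist_crossingTriangles_le_one_iff]
      exact (Metric.dist_le_diam_of_mem (s.finite_toSet.image _).isBounded
        (Set.mem_image_of_mem _ hi) (Set.mem_image_of_mem _ hj)).trans h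
    · intro h
      refine Metric.diam_le_of_forall_dist_le zero_le_one ?_
      rintro _ ⟨i, hi, rfl⟩ _ ⟨j, hj, rfl⟩
      exact (dist_crossingTriangles_le_one_iff i j).2 (h i hi j hj)
  show s.Nonempty ∧ _ ↔ _
  rw [hd]
  refine and_congr_right fun _ => ⟨fun h => ⟨fun h' => ?_, fun h' => ?_, fun h' => ?_⟩, ?_⟩
  · exact h _ h'.1 _ h'.2 rfl
  · exact h _ h'.1 _ h'.2 rfl
  · exact h _ h'.1 _ h'.2 rfl
  · rintro ⟨h0, h1, h2⟩ i hi j hj rfl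
    fin_cases i
    exacts [h0 ⟨hi, hj⟩, h1 ⟨hi, hj⟩, h2 ⟨hi, hj⟩, h0 ⟨hj, hi⟩, h1 ⟨hj, hi⟩, h2 ⟨hj, hi⟩]

theorem isomorphic_ripsComplex_octahedron :
    Isomorphic (ripsComplex crossingTriangles) octahedron := by
  let e : Fin 6 ≃ Fin 3 × Bool :=
    { toFun := ![(0, true), (1, true), (2, true), (0, false), (1, false), (2, false)]
      invFun := fun v => if v.2 then ![0, 1, 2] v.1 else ![3, 4, 5] v.1
      left_inv := by decide
      right_inv := by decide }
  refine ⟨e, fun s => ?_⟩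
  rw [mem_ripsComplex_crossingTriangles]
  show _ ↔ (s.map e.toEmbedding).Nonempty ∧ ∀ i : Fin 3, ¬ (_ ∈ s.map e.toEmbedding ∧
    _ ∈ s.map e.toEmbedding)
  simp only [Finset.map_nonempty, Finset.mem_map_equiv, Fin.forall_fin_succ]
  simp [e]

theorem mem_realization_crossingTriangles {w : Fin 6 → ℝ} :
    w ∈ realization (ripsComplex crossingTriangles) ↔
      w ∈ stdSimplex ℝ (Fin 6) ∧ w 0 * w 3 = 0 ∧ w 1 * w 4 = 0 ∧ w 2 * w 5 = 0 := by
  refine and_congr_right fun hw => ⟨?_, fun h => ?_⟩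
  · rintro ⟨s, hs, hws⟩
    obtain ⟨-, h0, h1, h2⟩ := mem_ripsComplex_crossingTriangles.1 hs
    simp only [mul_eq_zero]
    refine ⟨?_, ?_, ?_⟩ <;> by_contra! h
    exacts [h0 ⟨hws _ h.1, hws _ h.2⟩, h1 ⟨hws _ h.1, hws _ h.2⟩, h2 ⟨hws _ h.1, hws _ h.2⟩]
  -- The support of `w` serves as the simplex; it is nonempty because the weights sum to `1`.
  · refine ⟨Finset.univ.filter fun v => w v ≠ 0, mem_ripsComplex_crossingTriangles.2 ?_, by simp⟩
    simp only [mul_eq_zero] at h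
    refine ⟨?_, by simp; tauto, by simp; tauto, by simp; tauto⟩
    by_contra hne
    rw [Finset.not_nonempty_iff_eq_empty, Finset.filter_eq_empty_iff] at hne
    have := hw.2
    simp_all

abbrev rips : Set (Fin 6 → ℝ) := realization (ripsComplex crossingTriangles)

theorem sum_eq_one (w : rips) : w.1 0 + w.1 1 + w.1 2 + w.1 3 + w.1 4 + w.1 5 = 1 := by
  rw [← Fin.sum_univ_six]; exact w.2.1.2

theorem isCompact_rips : IsCompact rips := by
  refine (isCompact_stdSimplex ℝ (Fin 6)).of_isClosed_subset ?_ fun w hw => hw.1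
  have : rips = stdSimplex ℝ (Fin 6) ∩ ({w | w 0 * w 3 = 0} ∩ ({w | w 1 * w 4 = 0} ∩
      {w | w 2 * w 5 = 0})) := Set.ext fun w => mem_realization_crossingTriangles
  rw [this]
  have hc : ∀ i j : Fin 6, IsClosed {w : Fin 6 → ℝ | w i * w j = 0} := fun i j =>
    isClosed_eq (by fun_prop) continuous_const
  exact (isClosed_stdSimplex ℝ _).inter ((hc _ _).inter ((hc _ _).inter (hc _ _)))

/-! ### The realization as a round sphere. -/

/-- Axial coordinate of a point of `ℝ³`, read off from barycentric coordinates. -/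
def axial (w : Fin 6 → ℝ) : ℝ := w 0 + w 1 + w 2 - w 3 - w 4 - w 5

/-- Transverse coordinate of a point of `ℝ³`, read off from barycentric coordinates. -/
def transverse (w : Fin 6 → ℝ) : ℂ :=
  ⟨(w 0 - w 3) - (w 1 - w 4), (w 1 - w 4) - (w 2 - w 5)⟩

/-- In the coordinates `xᵢ = wᵢ - wᵢ₊₃` the realization is the octahedron `|x₀| + |x₁| + |x₂| = 1`,
and `(axial, transverse)` is an invertible linear function of `x` that puts the two barycenters on
the axis. Division by `radius` is the radial projection to the unit sphere. -/
noncomputable def radius (w : Fin 6 → ℝ) : ℝ := √(axial w ^ 2 + ‖transverse w‖ ^ 2)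

theorem continuous_axial : Continuous axial := by unfold axial; fun_prop

theorem continuous_transverse : Continuous transverse := by
  have : transverse = fun w => (((w 0 - w 3) - (w 1 - w 4) : ℝ) : ℂ) +
      (((w 1 - w 4) - (w 2 - w 5) : ℝ) : ℂ) * Complex.I := by
    ext w; exact Complex.mk_eq_add_mul_I _ _
  rw [this]
  exact (Complex.continuous_ofReal.comp (by fun_prop)).add
    ((Complex.continuous_ofReal.comp (by fun_prop)).mul continuous_const)

theorem continuous_radius : Continuous radius :=
  ((continuous_axial.pow 2).add (continuous_transverse.norm.pow 2)).sqrt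

/-- Two pairs of complementary nonnegative numbers with proportional differences are
proportional. -/
theorem eq_mul_of_sub_eq_mul_sub {a b c d l : ℝ} (ha : 0 ≤ a) (hb : 0 ≤ b) (hc : 0 ≤ c)
    (hd : 0 ≤ d) (hab : a * b = 0) (hcd : c * d = 0) (hl : 0 < l) (h : a - b = l * (c - d)) :
    a = l * c ∧ b = l * d := by
  rcases mul_eq_zero.1 hab with rfl | rfl <;> rcases mul_eq_zero.1 hcd with rfl | rfl
  · constructor <;> linarith
  · have := mul_nonneg hl.le hc
    constructor <;> linarith
  · have := mul_nonneg hl.le hd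
    constructor <;> linarith
  · constructor <;> linarith

theorem radius_pos (w : rips) : 0 < radius w.1 := by
  refine Real.sqrt_pos.2 ?_
  by_contra! h
  have h1 : axial w.1 = 0 := by nlinarith [sq_nonneg (axial w.1), sq_nonneg ‖transverse w.1‖]
  have h2 : transverse w.1 = 0 :=
    norm_eq_zero.1 (by nlinarith [sq_nonneg (axial w.1), sq_nonneg ‖transverse w.1‖])
  have h3 := congrArg Complex.re h2
  have h4 := congrArg Complex.im h2
  simp only [axial, transverse, Complex.zero_re, Complex.zero_im] at h1 h3 h4
  obtain ⟨hw, e0, e1, e2⟩ := mem_realization_crossingTriangles.1 w.2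
  have hs := sum_eq_one w
  have f0 : w.1 0 = w.1 3 := by linarith
  have f1 : w.1 1 = w.1 4 := by linarith
  have f2 : w.1 2 = w.1 5 := by linarith
  rw [f0, mul_self_eq_zero] at e0
  rw [f1, mul_self_eq_zero] at e1
  rw [f2, mul_self_eq_zero] at e2
  linarith

theorem radius_sq (w : Fin 6 → ℝ) : radius w ^ 2 = axial w ^ 2 + ‖transverse w‖ ^ 2 :=
  Real.sq_sqrt (by positivity)

theorem abs_axial_div_radius_le (w : rips) : |axial w.1 / radius w.1| ≤ 1 := by
  have hR := radius_pos w
  rw [abs_div, abs_of_pos hR, div_le_one hR]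
  exact abs_le_of_sq_le_sq (by nlinarith [radius_sq w.1, sq_nonneg ‖transverse w.1‖]) hR.le

/-- The realization, a polyhedral sphere, mapped to a round sphere. -/
noncomputable def toChainLink (w : rips) : chainLink :=
  ⟨(Real.arccos (axial w.1 / radius w.1) / Real.pi, transverse w.1 / radius w.1), by
    have hR := radius_pos w
    have hpi := Real.pi_pos
    refine ⟨?_, div_nonneg (Real.arccos_nonneg _) hpi.le,
      (div_le_one hpi).2 (Real.arccos_le_pi _)⟩
    have h : 1 - (axial w.1 / radius w.1) ^ 2 = (‖transverse w.1‖ / radius w.1) ^ 2 := by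
      field_simp
      linarith [radius_sq w.1]
    simp only [sphereChain, Set.mem_ofPred_eq]
    rw [mul_div_cancel₀ _ hpi.ne', Real.sin_arccos, h, Real.sqrt_sq (by positivity), norm_div,
      Complex.norm_real, Real.norm_of_nonneg hR.le, abs_of_nonneg (by positivity)]⟩

theorem continuous_toChainLink : Continuous toChainLink := by
  have hR : Continuous fun w : rips => radius w.1 :=
    continuous_radius.comp continuous_subtype_val
  refine Continuous.subtype_mk (Continuous.prodMk ?_ ?_) _
  · exact (Real.continuous_arccos.comp ((continuous_axial.comp continuous_subtype_val).div hR
      fun w => (radius_pos w).ne')).div_const _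
  · exact (continuous_transverse.comp continuous_subtype_val).div
      (Complex.continuous_ofReal.comp hR)
      fun w => Complex.ofReal_ne_zero.2 (radius_pos w).ne'

/-- Equal images mean that the differences `wᵢ - wᵢ₊₃` are proportional with a positive factor `l`.
Complementarity recovers the weights as positive and negative parts, and the total weight `1` forces
`l = 1`. -/
theorem toChainLink_injective : Function.Injective toChainLink := by
  intro w w' h
  have hR := radius_pos w
  have hR' := radius_pos w'
  have h1 := congrArg (fun z : chainLink => z.1.1) h
  have h2 := congrArg (fun z : chainLink => z.1.2) h
  simp only [toChainLink] at h1 h2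
  rw [div_left_inj' Real.pi_ne_zero] at h1
  replace h1 := Real.arccos_injOn (abs_le.1 (abs_axial_div_radius_le w))
    (abs_le.1 (abs_axial_div_radius_le w')) h1
  set l := radius w.1 / radius w'.1
  have hl : 0 < l := div_pos hR hR'
  have h3 : axial w.1 = l * axial w'.1 := by
    simp only [l]; field_simp at h1 ⊢; linarith
  have h4 : transverse w.1 = (l : ℂ) * transverse w'.1 := by
    have e : (radius w.1 : ℂ) ≠ 0 := Complex.ofReal_ne_zero.2 hR.ne'
    have e' : (radius w'.1 : ℂ) ≠ 0 := Complex.ofReal_ne_zero.2 hR'.ne'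
    simp only [l, Complex.ofReal_div]
    rw [div_eq_div_iff e e'] at h2
    field_simp
    linear_combination h2
  have h5 := congrArg Complex.re h4
  have h6 := congrArg Complex.im h4
  rw [Complex.re_ofReal_mul] at h5
  rw [Complex.im_ofReal_mul] at h6
  simp only [axial, transverse] at h3 h5 h6
  obtain ⟨hw, e0, e1, e2⟩ := mem_realization_crossingTriangles.1 w.2
  obtain ⟨hw', e0', e1', e2'⟩ := mem_realization_crossingTriangles.1 w'.2
  obtain ⟨f0, f3⟩ := eq_mul_of_sub_eq_mul_sub (hw.1 0) (hw.1 3) (hw'.1 0) (hw'.1 3) e0 e0' hl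
    (by linarith)
  obtain ⟨f1, f4⟩ := eq_mul_of_sub_eq_mul_sub (hw.1 1) (hw.1 4) (hw'.1 1) (hw'.1 4) e1 e1' hl
    (by linarith)
  obtain ⟨f2, f5⟩ := eq_mul_of_sub_eq_mul_sub (hw.1 2) (hw.1 5) (hw'.1 2) (hw'.1 5) e2 e2' hl
    (by linarith)
  have hl1 : l = 1 := by
    have := sum_eq_one w
    rw [f0, f1, f2, f3, f4, f5] at this
    linear_combination this - l * sum_eq_one w'
  rw [hl1, one_mul] at f0 f1 f2 f3 f4 f5
  ext v
  fin_cases v <;> assumption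

theorem toChainLink_surjective : Function.Surjective toChainLink := by
  rintro ⟨⟨t, y⟩, hy, ht0, ht1⟩
  have hy : ‖y‖ = |Real.sin (Real.pi * t)| := hy
  have hpi := Real.pi_pos
  set m := Real.cos (Real.pi * t) with hm
  have hmy : m ^ 2 + ‖y‖ ^ 2 = 1 := by rw [hy, sq_abs, Real.cos_sq_add_sin_sq]
  -- These solve `a + b + c = m`, `a - b = y.re`, `b - c = y.im`. The preimage has as weights the
  -- positive and negative parts of `a, b, c`, divided by `N = |a| + |b| + |c|`.
  obtain ⟨a, ha⟩ : ∃ a, a = (m + 2 * y.re + y.im) / 3 := ⟨_, rfl⟩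
  obtain ⟨b, hb⟩ : ∃ b, b = (m - y.re + y.im) / 3 := ⟨_, rfl⟩
  obtain ⟨c, hc⟩ : ∃ c, c = (m - y.re - 2 * y.im) / 3 := ⟨_, rfl⟩
  have hN : 0 < |a| + |b| + |c| := by
    by_contra! h
    have ha0 : a = 0 := abs_nonpos_iff.1 (by linarith [abs_nonneg b, abs_nonneg c])
    have hb0 : b = 0 := abs_nonpos_iff.1 (by linarith [abs_nonneg a, abs_nonneg c])
    have hc0 : c = 0 := abs_nonpos_iff.1 (by linarith [abs_nonneg a, abs_nonneg b])
    have h1 : m = 0 := by linarith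
    have h2 : y = 0 := Complex.ext (by simp; linarith) (by simp; linarith)
    rw [h1, h2] at hmy
    simp at hmy
  set N := |a| + |b| + |c| with hNdef
  let w : Fin 6 → ℝ := ![(|a| + a) / (2 * N), (|b| + b) / (2 * N), (|c| + c) / (2 * N),
    (|a| - a) / (2 * N), (|b| - b) / (2 * N), (|c| - c) / (2 * N)]
  have hpos : ∀ x : ℝ, 0 ≤ (|x| + x) / (2 * N) := fun x =>
    div_nonneg (by linarith [neg_abs_le x]) (by positivity)
  have hneg : ∀ x : ℝ, 0 ≤ (|x| - x) / (2 * N) := fun x =>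
    div_nonneg (by linarith [le_abs_self x]) (by positivity)
  have hmul : ∀ x : ℝ, (|x| + x) / (2 * N) * ((|x| - x) / (2 * N)) = 0 := fun x => by
    rw [div_mul_div_comm, show (|x| + x) * (|x| - x) = |x| ^ 2 - x ^ 2 by ring, sq_abs, sub_self,
      zero_div]
  have hw : w ∈ rips := by
    rw [mem_realization_crossingTriangles]
    refine ⟨⟨fun v => ?_, ?_⟩, hmul a, hmul b, hmul c⟩
    · fin_cases v
      exacts [hpos a, hpos b, hpos c, hneg a, hneg b, hneg c]
    · rw [Fin.sum_univ_six]
      show (|a| + a) / (2 * N) + (|b| + b) / (2 * N) + (|c| + c) / (2 * N) +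
        (|a| - a) / (2 * N) + (|b| - b) / (2 * N) + (|c| - c) / (2 * N) = 1
      field_simp
      rw [hNdef]
      ring
  have hax : axial w = m / N := by
    show (|a| + a) / (2 * N) + (|b| + b) / (2 * N) + (|c| + c) / (2 * N) -
        (|a| - a) / (2 * N) - (|b| - b) / (2 * N) - (|c| - c) / (2 * N) = m / N
    field_simp
    linarith
  have htr : transverse w = y / (N : ℂ) := by
    apply Complex.ext
    · rw [Complex.div_ofReal_re]
      show (|a| + a) / (2 * N) - (|a| - a) / (2 * N) -
        ((|b| + b) / (2 * N) - (|b| - b) / (2 * N)) = y.re / N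
      field_simp
      linarith
    · rw [Complex.div_ofReal_im]
      show (|b| + b) / (2 * N) - (|b| - b) / (2 * N) -
        ((|c| + c) / (2 * N) - (|c| - c) / (2 * N)) = y.im / N
      field_simp
      linarith
  have hr : radius w = 1 / N := by
    rw [radius, hax, htr, norm_div, Complex.norm_real, Real.norm_of_nonneg hN.le, div_pow, div_pow,
      ← add_div, hmy, Real.sqrt_div zero_le_one, Real.sqrt_one, Real.sqrt_sq hN.le]
  refine ⟨⟨w, hw⟩, Subtype.ext (Prod.ext ?_ ?_)⟩
  · show Real.arccos (axial w / radius w) / Real.pi = t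
    rw [hax, hr, div_div_div_cancel_right₀ hN.ne', div_one, hm,
      Real.arccos_cos (by positivity) (by nlinarith), mul_div_cancel_left₀ _ hpi.ne']
  · show transverse w / (radius w : ℂ) = y
    have : (N : ℂ) ≠ 0 := Complex.ofReal_ne_zero.2 hN.ne'
    rw [htr, hr]
    push_cast
    field_simp

instance : CompactSpace rips := isCompact_iff_compactSpace.1 isCompact_rips

noncomputable def ripsHomeomorph : rips ≃ₜ chainLink :=
  Continuous.homeoOfEquivCompactToT2
    (f := Equiv.ofBijective toChainLink ⟨toChainLink_injective, toChainLink_surjective⟩)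
    continuous_toChainLink

theorem ripsHomeomorph_apply (w : rips) : ripsHomeomorph w = toChainLink w := rfl

theorem simplyConnectedSpace_rips : SimplyConnectedSpace rips :=
  have := simplyConnectedSpace_chainLink
  ripsHomeomorph.toHomotopyEquiv.simplyConnectedSpace

/-! ### The double point of the projection and the shadow. -/

/-- The barycenter of the triangle with vertices `0, 1, 2`. -/
noncomputable def barycenter : rips :=
  ⟨![1 / 3, 1 / 3, 1 / 3, 0, 0, 0], mem_realization_crossingTriangles.2
    ⟨⟨fun v => by fin_cases v <;> norm_num, by rw [Fin.sum_univ_six]; simp; norm_num⟩,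
      by simp, by simp, by simp⟩⟩

/-- The barycenter of the triangle with vertices `3, 4, 5`. -/
noncomputable def barycenter' : rips :=
  ⟨![0, 0, 0, 1 / 3, 1 / 3, 1 / 3], mem_realization_crossingTriangles.2
    ⟨⟨fun v => by fin_cases v <;> norm_num, by rw [Fin.sum_univ_six]; simp; norm_num⟩,
      by simp, by simp, by simp⟩⟩

theorem toChainLink_barycenter : (toChainLink barycenter).1 = (0, 0) := by
  have h1 : axial barycenter.1 = 1 := by simp [axial, barycenter]; norm_num
  have h2 : transverse barycenter.1 = 0 := by
    apply Complex.ext <;> simp [transverse, barycenter]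
  have h3 : radius barycenter.1 = 1 := by simp [radius, h1, h2]
  simp [toChainLink, h1, h2, h3]

theorem toChainLink_barycenter' : (toChainLink barycenter').1 = (1, 0) := by
  have h1 : axial barycenter'.1 = -1 := by simp [axial, barycenter']; norm_num
  have h2 : transverse barycenter'.1 = 0 := by
    apply Complex.ext <;> simp [transverse, barycenter']
  have h3 : radius barycenter'.1 = 1 := by simp [radius, h1, h2]
  simp [toChainLink, h1, h2, h3, Real.pi_ne_zero]

theorem projFun_crossingTriangles (w : rips) :
    projFun _ crossingTriangles w =
      !₂[-w.1 1 / 2 + w.1 2 / 2 + 3 / 10 * w.1 4 - 3 / 10 * w.1 5,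
        4 / 7 * w.1 0 - 2 / 7 * w.1 1 - 2 / 7 * w.1 2 - 12 / 35 * w.1 3 + 6 / 35 * w.1 4 +
          6 / 35 * w.1 5,
        -2 / 5 * w.1 4 + 2 / 5 * w.1 5,
        16 / 35 * w.1 3 - 8 / 35 * w.1 4 - 8 / 35 * w.1 5] := by
  rw [projFun, Fin.sum_univ_six]
  ext k
  fin_cases k <;> simp [crossingTriangles] <;> ring

theorem projFun_barycenter : projFun _ crossingTriangles barycenter =
    projFun _ crossingTriangles barycenter' := by
  rw [projFun_crossingTriangles, projFun_crossingTriangles]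
  congr 1
  ext k
  fin_cases k <;> simp [barycenter, barycenter'] <;> norm_num

/-- If the coordinates of `w` exceed those of `w'` by `c > 0` on one triangle and fall short of
them by `c` on the opposite one, then `w` and `w'` are the two barycenters. -/
theorem eq_barycenter_of_sub {w w' : rips} {c : ℝ} (hc : 0 < c) (h0 : w.1 0 = w'.1 0 + c)
    (h1 : w.1 1 = w'.1 1 + c) (h2 : w.1 2 = w'.1 2 + c) (h3 : w'.1 3 = w.1 3 + c)
    (h4 : w'.1 4 = w.1 4 + c) (h5 : w'.1 5 = w.1 5 + c) : w = barycenter ∧ w' = barycenter' := by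
  obtain ⟨hw, e0, e1, e2⟩ := mem_realization_crossingTriangles.1 w.2
  obtain ⟨hw', e0', e1', e2'⟩ := mem_realization_crossingTriangles.1 w'.2
  -- Since `c > 0`, `w` has positive weights on `0, 1, 2` and `w'` on `3, 4, 5`. Complementarity
  -- kills the other weights, so all the remaining ones equal `c`.
  have z3 := (mul_eq_zero.1 e0).resolve_left (by linarith [hw'.1 0])
  have z4 := (mul_eq_zero.1 e1).resolve_left (by linarith [hw'.1 1])
  have z5 := (mul_eq_zero.1 e2).resolve_left (by linarith [hw'.1 2])
  have z0 := (mul_eq_zero.1 e0').resolve_right (by linarith [hw.1 3])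
  have z1 := (mul_eq_zero.1 e1').resolve_right (by linarith [hw.1 4])
  have z2 := (mul_eq_zero.1 e2').resolve_right (by linarith [hw.1 5])
  have hs := sum_eq_one w
  have hc3 : c = 1 / 3 := by linarith
  constructor <;> ext v <;> fin_cases v <;> simp [barycenter, barycenter'] <;> linarith

theorem projFun_eq_iff {w w' : rips} :
    projFun _ crossingTriangles w = projFun _ crossingTriangles w' ↔
      w = w' ∨ (w = barycenter ∧ w' = barycenter') ∨ (w' = barycenter ∧ w = barycenter') := by
  constructor
  · intro h
    rw [projFun_crossingTriangles, projFun_crossingTriangles] at h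
    have h0 := congrArg (fun q : EuclideanSpace ℝ (Fin 4) => q 0) h
    have h1 := congrArg (fun q : EuclideanSpace ℝ (Fin 4) => q 1) h
    have h2 := congrArg (fun q : EuclideanSpace ℝ (Fin 4) => q 2) h
    have h3 := congrArg (fun q : EuclideanSpace ℝ (Fin 4) => q 3) h
    simp at h0 h1 h2 h3
    have hs := sum_eq_one w
    have hs' := sum_eq_one w'
    -- The four coordinate equations and the equality of total weights leave one free parameter `c`.
    obtain ⟨c, hc⟩ : ∃ c, w.1 0 = w'.1 0 + c := ⟨w.1 0 - w'.1 0, by ring⟩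
    have c1 : w.1 1 = w'.1 1 + c := by linarith
    have c2 : w.1 2 = w'.1 2 + c := by linarith
    have c3 : w'.1 3 = w.1 3 + c := by linarith
    have c4 : w'.1 4 = w.1 4 + c := by linarith
    have c5 : w'.1 5 = w.1 5 + c := by linarith
    rcases lt_trichotomy c 0 with hneg | rfl | hpos
    · refine Or.inr (Or.inr (eq_barycenter_of_sub (c := -c) ?_ ?_ ?_ ?_ ?_ ?_ ?_)) <;> linarith
    · rw [add_zero] at hc c1 c2 c3 c4 c5
      left
      ext v
      fin_cases v
      exacts [hc, c1, c2, c3.symm, c4.symm, c5.symm]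
    · exact Or.inr (Or.inl (eq_barycenter_of_sub hpos hc c1 c2 c3 c4 c5))
  · rintro (rfl | ⟨rfl, rfl⟩ | ⟨rfl, rfl⟩)
    exacts [rfl, projFun_barycenter, projFun_barycenter.symm]

/-- The barycenters go to the poles at heights `0` and `1`, the only points of `chainLink` that an
integer translation identifies. This matches the fibre condition in
`nonempty_fundamentalGroup_mulEquiv_int_of_gluing`. -/
theorem proj_eq_iff {w w' : rips} :
    proj _ crossingTriangles w = proj _ crossingTriangles w' ↔
      (toChainLink w).1.2 = (toChainLink w').1.2 ∧
        ∃ n : ℤ, (toChainLink w).1.1 = (toChainLink w').1.1 + n := by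
  have hpole : ∀ {w w' : rips}, (toChainLink w).1.1 = (toChainLink w').1.1 + 1 →
      w' = barycenter ∧ w = barycenter' := by
    intro w w' h
    have h1 := (toChainLink w).2.2.2
    have h0 := (toChainLink w').2.2.1
    have e0 : (toChainLink w').1.1 = (0 : ℤ) := by push_cast; linarith
    have e1 : (toChainLink w).1.1 = (1 : ℤ) := by push_cast; linarith
    constructor <;> refine toChainLink_injective (Subtype.ext ?_)
    · rw [toChainLink_barycenter]
      exact Prod.ext (by simpa using e0) (sphereChain.eq_zero_of_int (toChainLink w').2.1 e0)
    · rw [toChainLink_barycenter']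
      exact Prod.ext (by simpa using e1) (sphereChain.eq_zero_of_int (toChainLink w).2.1 e1)
  have hval : proj _ crossingTriangles w = proj _ crossingTriangles w' ↔
      projFun _ crossingTriangles w = projFun _ crossingTriangles w' := Subtype.ext_iff
  rw [hval, projFun_eq_iff]
  constructor
  · rintro (rfl | ⟨rfl, rfl⟩ | ⟨rfl, rfl⟩)
    · exact ⟨rfl, 0, by simp⟩
    · rw [toChainLink_barycenter, toChainLink_barycenter']
      exact ⟨rfl, -1, by simp⟩
    · rw [toChainLink_barycenter, toChainLink_barycenter']
      exact ⟨rfl, 1, by simp⟩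
  · rintro ⟨hy, n, hn⟩
    have b1 := (toChainLink w).2.2
    have b2 := (toChainLink w').2.2
    have n1 : n < 2 := by exact_mod_cast (by linarith : (n : ℝ) < 2)
    have n2 : -2 < n := by exact_mod_cast (by linarith : (-2 : ℝ) < n)
    obtain rfl | rfl | rfl : n = -1 ∨ n = 0 ∨ n = 1 := by omega
    · exact Or.inr (Or.inl (hpole (by push_cast at hn; linarith)))
    · exact Or.inl (toChainLink_injective (Subtype.ext (Prod.ext (by simpa using hn) hy)))
    · exact Or.inr (Or.inr (hpole (by push_cast at hn; linarith)))

theorem proj_surjective : Function.Surjective (proj _ crossingTriangles :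
    rips → shadow (ripsComplex crossingTriangles) crossingTriangles) := by
  rintro ⟨_, w, rfl⟩
  exact ⟨w, rfl⟩

theorem nonempty_fundamentalGroup_shadow
    (y : shadow (ripsComplex crossingTriangles) crossingTriangles) :
    Nonempty (FundamentalGroup (shadow (ripsComplex crossingTriangles) crossingTriangles) y ≃*
      Multiplicative ℤ) := by
  refine nonempty_fundamentalGroup_mulEquiv_int_of_gluing
    (g := proj _ crossingTriangles ∘ ripsHomeomorph.symm)
    ((proj _ crossingTriangles).continuous.comp ripsHomeomorph.symm.continuous)
    (proj_surjective.comp ripsHomeomorph.symm.surjective) (fun x x' => ?_) y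
  simp only [Function.comp_apply]
  rw [proj_eq_iff, ← ripsHomeomorph_apply, ← ripsHomeomorph_apply, Homeomorph.apply_symm_apply,
    Homeomorph.apply_symm_apply]

end RipsShadow

theorem mainTheorem8 :
    ∃ p : Fin 6 → EuclideanSpace ℝ (Fin 4),
      Function.Injective p ∧
      RipsShadow.Isomorphic (RipsShadow.ripsComplex p) RipsShadow.octahedron ∧
      SimplyConnectedSpace (RipsShadow.realization (RipsShadow.ripsComplex p)) ∧
      PathConnectedSpace (RipsShadow.shadow (RipsShadow.ripsComplex p) p) ∧
      (∀ y : RipsShadow.shadow (RipsShadow.ripsComplex p) p,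
        Nonempty (FundamentalGroup (RipsShadow.shadow (RipsShadow.ripsComplex p) p) y ≃*
          Multiplicative ℤ)) ∧
      ¬ RipsShadow.IsKConnectedMap 1 (RipsShadow.proj (RipsShadow.ripsComplex p) p) := by
  have := RipsShadow.simplyConnectedSpace_rips
  refine ⟨RipsShadow.crossingTriangles, RipsShadow.crossingTriangles_injective,
    RipsShadow.isomorphic_ripsComplex_octahedron, this,
    RipsShadow.proj_surjective.pathConnectedSpace (ContinuousMap.continuous _),
    RipsShadow.nonempty_fundamentalGroup_shadow, fun h => ?_⟩
  have hb := h.2 1 le_rfl le_rfl RipsShadow.barycenter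
  obtain ⟨e⟩ := RipsShadow.nonempty_fundamentalGroup_shadow
    (RipsShadow.proj _ _ RipsShadow.barycenter)
  have h1 : Subsingleton (HomotopyGroup.Pi 1 RipsShadow.rips RipsShadow.barycenter) :=
    HomotopyGroup.pi1EquivFundamentalGroup.subsingleton
  -- Surjectivity on `π₁` is what fails: it would make `ℤ` trivial.
  have h2 := hb.2.subsingleton
  have h3 := (HomotopyGroup.pi1EquivFundamentalGroup.trans e.toEquiv).symm.subsingleton
  exact not_subsingleton (Multiplicative ℤ) h3
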